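/- Let $\kappa>0$ and let $(X,d)$ be a complete geodesic metric space of curvature bounded above by $\kappa$ in the sense of Alexandrov (a complete CAT($\kappa$) space), i.e. every geodesic triangle of perimeter less than $2\pi/\sqrt{\kappa}$ is not thicker than its comparison triangle on the round sphere of radius $1/\sqrt{\kappa}$. Let $G\subset X$ be a closed, geodesically convex set (all minimal geodesics between points of $G$ lie in $G$) with $\operatorname{diam} G<\pi/(2\sqrt{\kappa})$. Let $\mu$ be a Borel probability measure on $G$, and let $f:G\to\mathbb{R}$ be a (geodesically) convex, lower semi-continuous function, that is, $f(\gamma(t))\le(1-t)f(\gamma(0))+tf(\gamma(1))$ for every minimal geodesic $\gamma:[0,1]\to G$ and $t\in[0,1]$. Then the function $y\mapsto\int_G d(a,y)^2\,d\mu(a)$ has a unique minimizer $\mathbb{E}\mu$ in $G$, the integral $\int_G f\,d\mu$ is well defined in $(-\infty,\infty]$, and $$f(\mathbb{E}\mu)\le\int_G f(a)\,d\mu(a).$$ -/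

import Mathlib

open MeasureTheory

/-- A curve `γ : [0,1] → Y` in a metric space is a *minimal geodesic* (of constant speed) if
`d (γ s) (γ t) = |s - t| * d (γ 0) (γ 1)` for all `s, t`. Continuity is then automatic. -/
def IsMinimalGeodesic {Y : Type*} [MetricSpace Y] (γ : unitInterval → Y) : Prop :=
  ∀ s t : unitInterval, dist (γ s) (γ t) = |(s : ℝ) - (t : ℝ)| * dist (γ 0) (γ 1)

/-- A metric space is *geodesic* if any two points are joined by a minimal geodesic. -/
def IsGeodesicSpace (Y : Type*) [MetricSpace Y] : Prop :=
  ∀ x y : Y, ∃ γ : unitInterval → Y, IsMinimalGeodesic γ ∧ γ 0 = x ∧ γ 1 = y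

/-- A set `G` is *geodesically convex* if every minimal geodesic between two points of `G` is
contained in `G`. -/
def IsGeodesicallyConvex {X : Type*} [MetricSpace X] (G : Set X) : Prop :=
  ∀ γ : unitInterval → X, IsMinimalGeodesic γ → γ 0 ∈ G → γ 1 ∈ G → ∀ t, γ t ∈ G

/-- A real function on a metric space is *(geodesically) convex* if
`f (x #_t y) ≤ (1 - t) f x + t f y` along every minimal geodesic. -/
def IsGeodesicallyConvexFun {Y : Type*} [MetricSpace Y] (f : Y → ℝ) : Prop :=
  ∀ γ : unitInterval → Y, IsMinimalGeodesic γ →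
    ∀ t : unitInterval, f (γ t) ≤ (1 - (t : ℝ)) * f (γ 0) + (t : ℝ) * f (γ 1)

/-- The points of the model surface of constant curvature `κ > 0`. The round sphere of radius
`1 / √κ` is represented by the unit sphere in `ℝ³` with a rescaled distance, `modelDist κ`. -/
abbrev ModelSphere : Type := Metric.sphere (0 : EuclideanSpace ℝ (Fin 3)) 1

/-- The Riemannian distance of the model surface of constant curvature `κ > 0`: the length of
the shorter great-circle arc on the sphere of radius `1 / √κ`. -/
noncomputable def modelDist (κ : ℝ) (u v : ModelSphere) : ℝ :=
  InnerProductGeometry.angle (u : EuclideanSpace ℝ (Fin 3)) (v : EuclideanSpace ℝ (Fin 3)) / √κ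

/-- `X` is an Alexandrov space of curvature bounded above by `κ > 0` (a CAT(κ) space): it is
geodesic, and every triangle `x, y, z` of perimeter less than `2π / √κ` is not thicker than its
comparison triangle `x', y', z'` in the model sphere of curvature `κ`. The point of the model
geodesic from `y'` to `z'` at parameter `t` is the point `m'` at distance `t * d(y, z)` from `y'`
and `(1 - t) * d(y, z)` from `z'`. -/
def CurvatureBoundedAbove (X : Type*) [MetricSpace X] (κ : ℝ) : Prop :=
  IsGeodesicSpace X ∧
  ∀ (x y z : X), dist x y + dist y z + dist z x < 2 * Real.pi / √κ →
    ∀ (γ : unitInterval → X), IsMinimalGeodesic γ → γ 0 = y → γ 1 = z →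
    ∀ (x' y' z' : ModelSphere),
      modelDist κ x' y' = dist x y → modelDist κ y' z' = dist y z → modelDist κ z' x' = dist z x →
    ∀ (t : unitInterval) (m' : ModelSphere),
      modelDist κ y' m' = (t : ℝ) * dist y z → modelDist κ m' z' = (1 - (t : ℝ)) * dist y z →
      dist (γ t) x ≤ modelDist κ m' x'

/-- `b` is a *barycenter* of `μ`: a minimizer of `y ↦ ∫ d(a, y)² dμ(a)`. Used for probability
measures on bounded spaces, where the integrand is bounded and continuous. -/
def IsBarycenter {Y : Type*} [MetricSpace Y] [MeasurableSpace Y] (μ : Measure Y) (b : Y) : Prop :=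
  ∀ y : Y, ∫ a, dist a b ^ 2 ∂μ ≤ ∫ a, dist a y ^ 2 ∂μ

/-- The extended integral `∫ f⁺ dμ - ∫ f⁻ dμ` of a real function, which is the usual integral in
`(-∞, ∞]` as soon as `∫ f⁻ dμ < ∞`. -/
noncomputable def extIntegral {Y : Type*} [MeasurableSpace Y] (μ : Measure Y) (f : Y → ℝ) : EReal :=
  ((∫⁻ a, ENNReal.ofReal (f a) ∂μ : ENNReal) : EReal) -
    ((∫⁻ a, ENNReal.ofReal (-f a) ∂μ : ENNReal) : EReal)

/-! Write `r = √κ`. Everything about curvature is used through `SphericalComparison`, and the strict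
diameter bound through a constant `D < π / 2` bounding `r * dist`, so that `cos D > 0`. Then `-cos
(r d(·, b))` and `d(·, b)²` are uniformly convex at midpoints (`cos_midpoint`, `sq_dist_midpoint`).
Without compactness, nested closed midpoint-convex sets still meet (`nonempty_iInter`), so a
midpoint-convex lower semicontinuous function attains its minimum. This gives the barycenter and a
lower bound for `f`.

Jensen's inequality comes from a resolvent: let `y` minimize `τ f - cos (r d(·, b))`. The first
variation along the geodesic from `y` to `a` gives `r² (d(a, y)² - d(a, b)²) / 2 ≤ τ (f a - f y)`.
Integrating in `a`, the left side becomes nonnegative because `b` is the barycenter, so `f y ≤ ∫ f`.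
As `τ → 0`, `y → b`, and lower semicontinuity finishes. -/

/-! ### From comparison triangles to an inequality between cosines. -/

/-- The inequality between cosines of distances that a geodesic and a point of the sphere satisfy
with equality, the distances being multiplied by `r`. -/
def SphericalComparison (Y : Type*) [MetricSpace Y] (r : ℝ) : Prop :=
  ∀ (x : Y) (γ : unitInterval → Y), IsMinimalGeodesic γ → ∀ t : unitInterval,
    Real.sin ((1 - (t : ℝ)) * (r * dist (γ 0) (γ 1))) * Real.cos (r * dist (γ 0) x) +
      Real.sin ((t : ℝ) * (r * dist (γ 0) (γ 1))) * Real.cos (r * dist (γ 1) x) ≤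
    Real.sin (r * dist (γ 0) (γ 1)) * Real.cos (r * dist (γ t) x)

theorem exists_modelSphere (a b c : ℝ) (h : a ^ 2 + b ^ 2 + c ^ 2 = 1) :
    ∃ u : ModelSphere, (u : EuclideanSpace ℝ (Fin 3)) = !₂[a, b, c] := by
  refine ⟨⟨!₂[a, b, c], ?_⟩, rfl⟩
  simp [EuclideanSpace.norm_eq, Fin.sum_univ_three, h]

theorem angle_modelSphere (u v : ModelSphere) (a b c a' b' c' : ℝ)
    (hu : (u : EuclideanSpace ℝ (Fin 3)) = !₂[a, b, c])
    (hv : (v : EuclideanSpace ℝ (Fin 3)) = !₂[a', b', c']) :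
    InnerProductGeometry.angle (u : EuclideanSpace ℝ (Fin 3)) v =
      Real.arccos (a * a' + b * b' + c * c') := by
  have h1 : ‖(u : EuclideanSpace ℝ (Fin 3))‖ = 1 := by simp
  have h2 : ‖(v : EuclideanSpace ℝ (Fin 3))‖ = 1 := by simp
  rw [InnerProductGeometry.angle, h1, h2, hu, hv]
  simp [PiLp.inner_apply, Fin.sum_univ_three]
  ring_nf

/-- A comparison triangle on the sphere with sides `A`, `B`, `L`, and the point at parameter `t`
of its side of length `L`. -/
theorem exists_comparison_triangle {A B L t : ℝ} (hL : 0 < L) (hLπ : L < Real.pi / 2)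
    (hA : A ∈ Set.Ico 0 (Real.pi / 2)) (hB : B ∈ Set.Ico 0 (Real.pi / 2))
    (h1 : L ≤ A + B) (h2 : A ≤ L + B) (h3 : B ≤ L + A) (ht : t ∈ Set.Icc (0 : ℝ) 1) :
    ∃ x y z m : ModelSphere,
      InnerProductGeometry.angle (x : EuclideanSpace ℝ (Fin 3)) y = A ∧
      InnerProductGeometry.angle (y : EuclideanSpace ℝ (Fin 3)) z = L ∧
      InnerProductGeometry.angle (z : EuclideanSpace ℝ (Fin 3)) x = B ∧
      InnerProductGeometry.angle (y : EuclideanSpace ℝ (Fin 3)) m = t * L ∧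
      InnerProductGeometry.angle (m : EuclideanSpace ℝ (Fin 3)) z = (1 - t) * L ∧
      Real.sin L * Real.cos (InnerProductGeometry.angle (m : EuclideanSpace ℝ (Fin 3)) x) =
        Real.sin ((1 - t) * L) * Real.cos A + Real.sin (t * L) * Real.cos B := by
  obtain ⟨hA0, hA1⟩ := hA
  obtain ⟨hB0, hB1⟩ := hB
  obtain ⟨ht0, ht1⟩ := ht
  have hpi := Real.pi_pos
  have hs : 0 < Real.sin L := Real.sin_pos_of_pos_of_lt_pi hL (by linarith)
  have hsA : 0 ≤ Real.sin A := Real.sin_nonneg_of_nonneg_of_le_pi hA0 (by linarith)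
  -- With `y` and `z` on the equator and `y` the first basis vector, the cosine rule forces `u` as
  -- second coordinate of `x`. The triangle inequalities, through the addition formulas, say exactly
  -- that `|u| ≤ sin A`, which leaves room for the third coordinate.
  obtain ⟨u, hu⟩ : ∃ u, u = (Real.cos B - Real.cos L * Real.cos A) / Real.sin L := ⟨_, rfl⟩
  have hu' : Real.cos L * Real.cos A + Real.sin L * u = Real.cos B := by
    rw [hu]; field_simp; ring
  have hle : Real.cos (L + A) ≤ Real.cos B :=
    Real.cos_le_cos_of_nonneg_of_le_pi hB0 (by linarith) h3
  have hge : Real.cos B ≤ Real.cos (L - A) := by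
    rw [← Real.cos_abs (L - A)]
    exact Real.cos_le_cos_of_nonneg_of_le_pi (abs_nonneg _) (by linarith)
      (abs_le.2 ⟨by linarith, by linarith⟩)
  rw [Real.cos_add] at hle
  rw [Real.cos_sub] at hge
  have hu1 : |u| ≤ Real.sin A := by
    refine abs_le.2 ⟨?_, ?_⟩
    · refine le_of_mul_le_mul_left ?_ hs
      linarith
    · refine le_of_mul_le_mul_left ?_ hs
      linarith
  have hu2 : u ^ 2 ≤ Real.sin A ^ 2 := by
    rw [← sq_abs]; exact pow_le_pow_left₀ (abs_nonneg _) hu1 2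
  have hw : 0 ≤ 1 - Real.cos A ^ 2 - u ^ 2 := by
    have := Real.sin_sq_add_cos_sq A; linarith
  obtain ⟨x, hx⟩ := exists_modelSphere (Real.cos A) u (√(1 - Real.cos A ^ 2 - u ^ 2))
    (by rw [Real.sq_sqrt hw]; ring)
  obtain ⟨y, hy⟩ := exists_modelSphere 1 0 0 (by norm_num)
  obtain ⟨z, hz⟩ := exists_modelSphere (Real.cos L) (Real.sin L) 0
    (by have := Real.sin_sq_add_cos_sq L; linarith)
  obtain ⟨m, hm⟩ := exists_modelSphere (Real.cos (t * L)) (Real.sin (t * L)) 0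
    (by have := Real.sin_sq_add_cos_sq (t * L); linarith)
  have htL : t * L ≤ L := by nlinarith
  have htL0 : 0 ≤ t * L := by positivity
  refine ⟨x, y, z, m, ?_, ?_, ?_, ?_, ?_, ?_⟩
  · rw [angle_modelSphere x y _ _ _ _ _ _ hx hy]
    simpa using Real.arccos_cos hA0 (by linarith)
  · rw [angle_modelSphere y z _ _ _ _ _ _ hy hz]
    simpa using Real.arccos_cos hL.le (by linarith)
  · rw [angle_modelSphere z x _ _ _ _ _ _ hz hx, zero_mul, add_zero, hu']
    exact Real.arccos_cos hB0 (by linarith)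
  · rw [angle_modelSphere y m _ _ _ _ _ _ hy hm]
    simpa using Real.arccos_cos htL0 (by linarith)
  · rw [angle_modelSphere m z _ _ _ _ _ _ hm hz]
    rw [← Real.arccos_cos (x := (1 - t) * L) (by linarith) (by linarith), sub_mul, one_mul,
      Real.cos_sub]
    ring_nf
  · have h1 : ‖(m : EuclideanSpace ℝ (Fin 3))‖ = 1 := by simp
    have h2 : ‖(x : EuclideanSpace ℝ (Fin 3))‖ = 1 := by simp
    rw [InnerProductGeometry.cos_angle, h1, h2, hm, hx, sub_mul, one_mul, Real.sin_sub, ← hu']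
    simp [PiLp.inner_apply, Fin.sum_univ_three]
    ring

/-- On the sphere `sin L • m' = sin ((1 - t) L) • y' + sin (t L) • z'`, so pairing with `x'` gives
equality. In `G` the point `γ t` is at most as far from `x` as `m'` is from `x'`, and cosine
decreases on `[0, π]`. -/
theorem CurvatureBoundedAbove.sphericalComparison {X : Type*} [MetricSpace X] {κ : ℝ} (hκ : 0 < κ)
    (hX : CurvatureBoundedAbove X κ) {G : Set X}
    (hd : ∀ x ∈ G, ∀ y ∈ G, √κ * dist x y < Real.pi / 2) :
    SphericalComparison G √κ := by
  intro x γ hγ t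
  have hr : 0 < √κ := Real.sqrt_pos.2 hκ
  have hpi := Real.pi_pos
  rcases (dist_nonneg : 0 ≤ dist (γ 0) (γ 1)).eq_or_lt with h0 | h0
  · simp [← h0]
  · have hA := hd _ (γ 0).2 _ x.2
    have hB := hd _ (γ 1).2 _ x.2
    have hL := hd _ (γ 0).2 _ (γ 1).2
    simp only [← Subtype.dist_eq] at hA hB hL
    have hL0 := mul_pos hr h0
    have hA0 : 0 ≤ √κ * dist (γ 0) x := by positivity
    have hB0 : 0 ≤ √κ * dist (γ 1) x := by positivity
    have t1 := mul_le_mul_of_nonneg_left (dist_triangle_right (γ 0) (γ 1) x) hr.le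
    have t2 := mul_le_mul_of_nonneg_left (dist_triangle (γ 0) (γ 1) x) hr.le
    have t3 := mul_le_mul_of_nonneg_left (dist_triangle_left (γ 1) x (γ 0)) hr.le
    rw [mul_add] at t1 t2 t3
    obtain ⟨x', y', z', m', e1, e2, e3, e4, e5, e6⟩ :=
      exists_comparison_triangle hL0 hL ⟨hA0, hA⟩ ⟨hB0, hB⟩ t1 t2 t3 t.2
    have key := hX.2 x (γ 0) (γ 1) (by
      rw [lt_div_iff₀ hr]
      rw [← Subtype.dist_eq, ← Subtype.dist_eq, ← Subtype.dist_eq, dist_comm x]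
      linarith) (fun s => (γ s : X)) (fun s t => hγ s t) rfl rfl x' y' z'
      (by rw [modelDist, e1, div_eq_iff hr.ne', dist_comm, ← Subtype.dist_eq]; ring)
      (by rw [modelDist, e2, div_eq_iff hr.ne', ← Subtype.dist_eq]; ring)
      (by rw [modelDist, e3, div_eq_iff hr.ne', ← Subtype.dist_eq]; ring) t m'
      (by rw [modelDist, e4, div_eq_iff hr.ne', ← Subtype.dist_eq]; ring)
      (by rw [modelDist, e5, div_eq_iff hr.ne', ← Subtype.dist_eq]; ring)
    rw [← Subtype.dist_eq, modelDist, le_div_iff₀ hr, mul_comm] at key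
    rw [← e6]
    refine mul_le_mul_of_nonneg_left ?_
      (Real.sin_pos_of_pos_of_lt_pi hL0 (by linarith)).le
    exact Real.cos_le_cos_of_nonneg_of_le_pi (by positivity)
      (InnerProductGeometry.angle_le_pi _ _) key

theorem IsGeodesicSpace.subtype {X : Type*} [MetricSpace X] (hX : IsGeodesicSpace X) {G : Set X}
    (hG : IsGeodesicallyConvex G) : IsGeodesicSpace G := by
  intro x y
  obtain ⟨γ, hγ, h0, h1⟩ := hX x y
  exact ⟨fun t => ⟨γ t, hG γ hγ (h0 ▸ x.2) (h1 ▸ y.2) t⟩, fun s t => hγ s t, Subtype.ext h0,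
    Subtype.ext h1⟩

/-! ### Passing from cosines to squares. -/

/-- The function `x² sinc M + 2 cos x` has derivative `2 x (sinc M - sinc x)`, and `sinc` decreases
on `[0, π]` by concavity of sine, so its minimum there is at `x = M`. -/
theorem two_mul_cos_sub_cos_le {M d : ℝ} (hM : M ∈ Set.Icc 0 Real.pi) (hd : d ∈ Set.Icc 0 Real.pi) :
    2 * (Real.cos M - Real.cos d) ≤ (d ^ 2 - M ^ 2) * Real.sinc M := by
  have hs : ∀ {x y : ℝ}, 0 ≤ x → x ≤ y → y ≤ Real.pi → x * Real.sin y ≤ y * Real.sin x := by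
    intro x y hx hxy hy
    rcases hx.eq_or_lt with rfl | hx
    · simp
    have hy0 := hx.trans_le hxy
    have h1 : 0 ≤ 1 - x / y := by rw [sub_nonneg, div_le_one hy0]; exact hxy
    have h2 : 0 ≤ x / y := by positivity
    have := strictConcaveOn_sin_Icc.concaveOn.2 ⟨le_rfl, Real.pi_pos.le⟩
      (⟨hy0.le, hy⟩ : y ∈ Set.Icc 0 Real.pi) h1 h2 (by ring)
    simp only [smul_eq_mul, Real.sin_zero, mul_zero, zero_add] at this
    rw [div_mul_cancel₀ _ hy0.ne', div_mul_eq_mul_div, div_le_iff₀ hy0] at this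
    linarith
  have hMs : M * Real.sinc M = Real.sin M := by
    rcases eq_or_ne M 0 with rfl | h
    · simp
    · rw [Real.sinc_of_ne_zero h]; field_simp
  obtain ⟨h, hh⟩ : ∃ h : ℝ → ℝ, h = fun x => x ^ 2 * Real.sinc M + 2 * Real.cos x := ⟨_, rfl⟩
  have hder : ∀ x, HasDerivAt h (2 * (x * Real.sinc M - Real.sin x)) x := by
    intro x
    rw [hh]
    exact (((hasDerivAt_pow 2 x).mul_const (Real.sinc M)).add
      ((Real.hasDerivAt_cos x).const_mul 2)).congr_deriv (by norm_num; ring)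
  have hcont : Continuous h := by rw [hh]; fun_prop
  have hsinc : M = 0 → Real.sinc M = 1 := by rintro rfl; simp
  suffices h M ≤ h d by
    rw [hh] at this; simp only at this; linarith
  rcases le_total M d with hle | hle
  · refine monotoneOn_of_deriv_nonneg (convex_Icc M Real.pi) hcont.continuousOn
      (fun x _ => (hder x).differentiableAt.differentiableWithinAt) ?_ ⟨le_rfl, hM.2⟩ ⟨hle, hd.2⟩ hle
    intro x hx
    rw [interior_Icc] at hx
    rw [(hder x).deriv]
    rcases hM.1.eq_or_lt with h0 | h0
    · rw [hsinc h0.symm]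
      have := Real.sin_le (h0.le.trans hx.1.le)
      linarith
    · have := hs hM.1 hx.1.le hx.2.le
      rw [← hMs] at this
      have : M * Real.sin x ≤ M * (x * Real.sinc M) := by linarith
      have := le_of_mul_le_mul_left this h0
      linarith
  · refine antitoneOn_of_deriv_nonpos (convex_Icc 0 M) hcont.continuousOn
      (fun x _ => (hder x).differentiableAt.differentiableWithinAt) ?_ ⟨hd.1, hle⟩ ⟨hM.1, le_rfl⟩ hle
    intro x hx
    rw [interior_Icc] at hx
    rw [(hder x).deriv]
    have h0 := hx.1.trans hx.2
    have := hs hx.1.le hx.2.le hM.2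
    rw [← hMs] at this
    have : M * (x * Real.sinc M) ≤ M * Real.sin x := by linarith
    have := le_of_mul_le_mul_left this h0
    linarith

/-- The midpoint of the unit interval. -/
noncomputable def unitIntervalHalf : unitInterval := ⟨1 / 2, by norm_num, by norm_num⟩

theorem coe_unitIntervalHalf : (unitIntervalHalf : ℝ) = 1 / 2 := rfl

/-! ### Uniform convexity and existence of minimizers. -/

section SphericalComparison

variable {Y : Type*} [MetricSpace Y] {r D : ℝ}

/-- At `t = 1 / 2` the factor `sin (l / 2)` cancels and the comparison bounds the mean of the
cosines by `cos (l / 2)` times the cosine at the midpoint. The quadratic gap comes from `cos (l / 2)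
≤ 1 - l² / (2 π²)`, the midpoint cosine being at least `cos D`. -/
theorem SphericalComparison.cos_midpoint (hY : SphericalComparison Y r) (hr : 0 < r)
    (hD : D < Real.pi / 2) (hdist : ∀ x y : Y, r * dist x y ≤ D) (x : Y) {γ : unitInterval → Y}
    (hγ : IsMinimalGeodesic γ) :
    (Real.cos (r * dist (γ 0) x) + Real.cos (r * dist (γ 1) x)) / 2 +
      Real.cos D / (2 * Real.pi ^ 2) * (r * dist (γ 0) (γ 1)) ^ 2 ≤
    Real.cos (r * dist (γ unitIntervalHalf) x) := by
  have hpi := Real.pi_pos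
  have key := hY x γ hγ unitIntervalHalf
  have hM : Real.cos D ≤ Real.cos (r * dist (γ unitIntervalHalf) x) :=
    Real.cos_le_cos_of_nonneg_of_le_pi (by positivity) (by linarith) (hdist _ _)
  have hD0 : 0 ≤ D := by simpa using hdist x x
  have hcD : 0 < Real.cos D := Real.cos_pos_of_mem_Ioo ⟨by linarith, hD⟩
  obtain ⟨l, hl⟩ : ∃ l, l = r * dist (γ 0) (γ 1) := ⟨_, rfl⟩
  have hlD : l ≤ D := hl ▸ hdist _ _
  rw [← hl] at key ⊢
  rcases (dist_nonneg : 0 ≤ dist (γ 0) (γ 1)).eq_or_lt with h0 | h0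
  · have e1 : γ 1 = γ 0 := (dist_eq_zero.1 h0.symm).symm
    have e2 : γ unitIntervalHalf = γ 0 := dist_eq_zero.1 (by rw [hγ, ← h0, mul_zero])
    have e3 : l = 0 := by rw [hl, ← h0, mul_zero]
    rw [e1, e2, e3]
    linarith
  · have hl0 : 0 < l := hl ▸ mul_pos hr h0
    have hs : 0 < Real.sin (l / 2) :=
      Real.sin_pos_of_pos_of_lt_pi (by linarith) (by linarith)
    have hcos := Real.cos_le_one_sub_mul_cos_sq (x := l / 2)
      (by rw [abs_of_pos (by linarith)]; linarith)
    have e1 : (1 - ((unitIntervalHalf : unitInterval) : ℝ)) * l = l / 2 := by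
      rw [coe_unitIntervalHalf]; ring
    have e2 : ((unitIntervalHalf : unitInterval) : ℝ) * l = l / 2 := by
      rw [coe_unitIntervalHalf]; ring
    have e3 : Real.sin l = 2 * Real.sin (l / 2) * Real.cos (l / 2) := by
      rw [← Real.sin_two_mul]; ring_nf
    rw [e1, e2, e3] at key
    have h1 : Real.cos (r * dist (γ 0) x) + Real.cos (r * dist (γ 1) x) ≤
        2 * Real.cos (l / 2) * Real.cos (r * dist (γ unitIntervalHalf) x) := by
      refine le_of_mul_le_mul_left ?_ hs
      linarith
    have h2 : Real.cos D / (2 * Real.pi ^ 2) * l ^ 2 =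
        Real.cos D * (2 / Real.pi ^ 2 * (l / 2) ^ 2) := by
      field_simp
    have hnn : 0 ≤ 2 / Real.pi ^ 2 * (l / 2) ^ 2 := by positivity
    have h3 := mul_le_mul_of_nonneg_right hM hnn
    have h4 := mul_le_mul_of_nonneg_right hcos (hcD.le.trans hM)
    rw [h2]
    linarith

theorem sinc_pos_of_lt {x : ℝ} (h0 : 0 ≤ x) (h : x < Real.pi) : 0 < Real.sinc x := by
  rcases h0.eq_or_lt with rfl | h0
  · simp
  · rw [Real.sinc_of_ne_zero h0.ne']
    exact div_pos (Real.sin_pos_of_pos_of_lt_pi h0 h) h0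

theorem SphericalComparison.sq_dist_midpoint (hY : SphericalComparison Y r) (hr : 0 < r)
    (hD : D < Real.pi / 2) (hdist : ∀ x y : Y, r * dist x y ≤ D) (x : Y) {γ : unitInterval → Y}
    (hγ : IsMinimalGeodesic γ) :
    dist x (γ unitIntervalHalf) ^ 2 + Real.cos D / Real.pi ^ 2 * dist (γ 0) (γ 1) ^ 2 ≤
      (dist x (γ 0) ^ 2 + dist x (γ 1) ^ 2) / 2 := by
  have hpi := Real.pi_pos
  have key := hY.cos_midpoint hr hD hdist x hγ
  have hmem : ∀ y : Y, r * dist y x ∈ Set.Icc 0 Real.pi := fun y =>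
    ⟨by positivity, by linarith [hdist y x]⟩
  have hD0 : 0 ≤ D := by simpa using hdist x x
  have hcD : 0 < Real.cos D := Real.cos_pos_of_mem_Ioo ⟨by linarith, hD⟩
  have h0 := two_mul_cos_sub_cos_le (hmem (γ unitIntervalHalf)) (hmem (γ 0))
  have h1 := two_mul_cos_sub_cos_le (hmem (γ unitIntervalHalf)) (hmem (γ 1))
  have hs := sinc_pos_of_lt (hmem (γ unitIntervalHalf)).1
    (by linarith [hdist (γ unitIntervalHalf) x])
  have hs1 := Real.sinc_le_one (r * dist (γ unitIntervalHalf) x)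
  obtain ⟨P, hP⟩ : ∃ P, P = Real.cos D / Real.pi ^ 2 * dist (γ 0) (γ 1) ^ 2 := ⟨_, rfl⟩
  have hP0 : 0 ≤ P := by rw [hP]; positivity
  have hP' : Real.cos D / (2 * Real.pi ^ 2) * (r * dist (γ 0) (γ 1)) ^ 2 = r ^ 2 * P / 2 := by
    rw [hP]; field_simp
  rw [hP'] at key
  rw [← hP, dist_comm x, dist_comm x, dist_comm x]
  obtain ⟨Z, hZ⟩ : ∃ Z, Z = (dist (γ 0) x ^ 2 + dist (γ 1) x ^ 2) / 2 -
    dist (γ unitIntervalHalf) x ^ 2 := ⟨_, rfl⟩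
  have h3 : P ≤ Z * Real.sinc (r * dist (γ unitIntervalHalf) x) := by
    refine le_of_mul_le_mul_left ?_ (pow_pos hr 2)
    rw [hZ]
    linarith
  have hZ0 : 0 ≤ Z := nonneg_of_mul_nonneg_left (hP0.trans h3) hs
  have h4 := mul_le_of_le_one_right hZ0 hs1
  linarith

open Filter Topology

/-- As for projections in a Hilbert space: the points of `C n` almost nearest to `b` form sets whose
diameters shrink to zero by uniform convexity, so Cantor's intersection theorem applies. -/
theorem SphericalComparison.nonempty_iInter [CompleteSpace Y] (hY : SphericalComparison Y r)
    (hgeo : IsGeodesicSpace Y) (hr : 0 < r) (hD : D < Real.pi / 2)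
    (hdist : ∀ x y : Y, r * dist x y ≤ D) {C : ℕ → Set Y} (hanti : Antitone C)
    (hclosed : ∀ n, IsClosed (C n)) (hne : ∀ n, (C n).Nonempty)
    (hmid : ∀ n, ∀ γ : unitInterval → Y, IsMinimalGeodesic γ → γ 0 ∈ C n → γ 1 ∈ C n →
      γ unitIntervalHalf ∈ C n) :
    (⋂ n, C n).Nonempty := by
  obtain ⟨b, -⟩ := hne 0
  have hpi := Real.pi_pos
  have hD0 : 0 ≤ D := by simpa using hdist b b
  have hcD : 0 < Real.cos D := Real.cos_pos_of_mem_Ioo ⟨by linarith, hD⟩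
  obtain ⟨φ, hφ⟩ : ∃ φ : Y → ℝ, φ = fun x => Real.cos (r * dist x b) := ⟨_, rfl⟩
  have hφc : Continuous φ := by rw [hφ]; fun_prop
  have hbdd : ∀ n, BddAbove (φ '' C n) := fun n => by
    refine ⟨1, ?_⟩
    rintro _ ⟨x, -, rfl⟩
    rw [hφ]
    exact Real.cos_le_one _
  have hφ1 : ∀ x, -1 ≤ φ x := fun x => by rw [hφ]; exact Real.neg_one_le_cos _
  obtain ⟨S, hS⟩ : ∃ S : ℕ → ℝ, S = fun n => sSup (φ '' C n) := ⟨_, rfl⟩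
  have hle : ∀ n, ∀ x ∈ C n, φ x ≤ S n := fun n x hx => by
    rw [hS]; exact le_csSup (hbdd n) ⟨x, hx, rfl⟩
  have hSanti : Antitone S := by
    rw [hS]
    intro m n hmn
    exact csSup_le_csSup (hbdd m) ((hne n).image _) (Set.image_mono (hanti hmn))
  have hSbdd : BddBelow (Set.range S) := by
    refine ⟨-1, ?_⟩
    rintro _ ⟨n, rfl⟩
    obtain ⟨x, hx⟩ := hne n
    exact (hφ1 x).trans (hle n x hx)
  have hlim := tendsto_atTop_ciInf hSanti hSbdd
  obtain ⟨R, hR⟩ : ∃ R, R = ⨅ n, S n := ⟨_, rfl⟩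
  rw [← hR] at hlim
  have hRS : ∀ n, R ≤ S n := fun n => hR ▸ ciInf_le hSbdd n
  -- The threshold uses the limit `R` rather than `S n`, which keeps `T` nested; since `R ≤ S n`,
  -- each `T n` is still nonempty.
  obtain ⟨T, hT⟩ : ∃ T : ℕ → Set Y, T = fun n => C n ∩ {x | R - 1 / ((n : ℝ) + 1) ≤ φ x} :=
    ⟨_, rfl⟩
  have hTne : ∀ n, (T n).Nonempty := fun n => by
    have : R - 1 / ((n : ℝ) + 1) < sSup (φ '' C n) := by
      have h1 : 0 < 1 / ((n : ℝ) + 1) := by positivity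
      have h2 := hRS n
      rw [hS] at h2
      linarith
    obtain ⟨_, ⟨x, hx, rfl⟩, hlt⟩ := exists_lt_of_lt_csSup ((hne n).image _) this
    rw [hT]
    exact ⟨x, hx, hlt.le⟩
  have hTanti : Antitone T := by
    rw [hT]
    intro m n hmn x hx
    refine ⟨hanti hmn hx.1, (show R - 1 / ((m : ℝ) + 1) ≤ φ x from le_trans ?_ hx.2)⟩
    have := one_div_le_one_div_of_le (by positivity : (0 : ℝ) < (m : ℝ) + 1)
      (add_le_add_left (Nat.cast_le (α := ℝ).2 hmn) 1)
    linarith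
  have hTclosed : ∀ n, IsClosed (T n) := fun n => by
    rw [hT]
    exact (hclosed n).inter (isClosed_le continuous_const hφc)
  obtain ⟨c, hc⟩ : ∃ c, c = Real.cos D / (2 * Real.pi ^ 2) * r ^ 2 := ⟨_, rfl⟩
  have hc0 : 0 < c := by rw [hc]; positivity
  obtain ⟨ε, hε⟩ : ∃ ε : ℕ → ℝ, ε = fun n => (S n - R + 1 / ((n : ℝ) + 1)) / c := ⟨_, rfl⟩
  have hε0 : Tendsto (fun n => √(ε n)) atTop (𝓝 0) := by
    have h := ((hlim.sub_const R).add tendsto_one_div_add_atTop_nhds_zero_nat).div_const c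
    rw [sub_self, add_zero, zero_div] at h
    have h' := (Real.continuous_sqrt.tendsto 0).comp h
    rw [Real.sqrt_zero] at h'
    rw [hε]
    exact h'
  have hTdist : ∀ n, ∀ x ∈ T n, ∀ y ∈ T n, dist x y ≤ √(ε n) := by
    intro n x hx y hy
    rw [hT] at hx hy
    obtain ⟨γ, hγ, rfl, rfl⟩ := hgeo x y
    -- The midpoint lies in `C n`, so its cosine is at most `S n`; the uniform convexity gap is then
    -- at most `S n - R + 1 / (n + 1)`.
    have h1 := hle n _ (hmid n γ hγ hx.1 hy.1)
    have h2 := hY.cos_midpoint hr hD hdist b hγ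
    have h3 := hx.2
    have h4 := hy.2
    rw [hφ] at h1 h3 h4
    simp only [Set.mem_ofPred_eq] at h1 h3 h4
    rw [mul_pow, ← mul_assoc, ← hc] at h2
    refine Real.le_sqrt_of_sq_le ?_
    rw [hε]
    simp only
    rw [le_div_iff₀ hc0]
    linarith
  have hmain : (⋂ n, T n).Nonempty := by
    refine Metric.nonempty_iInter_of_nonempty_biInter hTclosed (fun n => ?_) (fun N => ?_) ?_
    · exact Metric.isBounded_iff.2 ⟨√(ε n), fun x hx y hy => hTdist n x hx y hy⟩
    · obtain ⟨x, hx⟩ := hTne N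
      exact ⟨x, Set.mem_iInter₂.2 fun n hn => hTanti hn hx⟩
    · exact squeeze_zero (fun n => Metric.diam_nonneg)
        (fun n => Metric.diam_le_of_forall_dist_le (Real.sqrt_nonneg _) (hTdist n)) hε0
  refine hmain.mono (Set.iInter_mono fun n => ?_)
  rw [hT]
  exact Set.inter_subset_left

theorem SphericalComparison.exists_forall_le [CompleteSpace Y] [Nonempty Y]
    (hY : SphericalComparison Y r) (hgeo : IsGeodesicSpace Y) (hr : 0 < r) (hD : D < Real.pi / 2)
    (hdist : ∀ x y : Y, r * dist x y ≤ D) {h : Y → ℝ} (hlsc : LowerSemicontinuous h)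
    (hmid : ∀ γ : unitInterval → Y, IsMinimalGeodesic γ →
      h (γ unitIntervalHalf) ≤ (h (γ 0) + h (γ 1)) / 2) :
    ∃ y, ∀ x, h y ≤ h x := by
  -- The infimum is taken in `EReal` because `h` is not assumed bounded below; that is a consequence
  -- of attainment.
  obtain ⟨u, hu, hlim, hmem⟩ := exists_seq_tendsto_sInf
    (Set.range_nonempty fun x => (h x : EReal)) (OrderBot.bddBelow _)
  choose p hp using hmem
  obtain ⟨y, hy⟩ := hY.nonempty_iInter hgeo hr hD hdist (C := fun n => {x | h x ≤ h (p n)})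
    (fun m n hmn x hx => by
      have := hu hmn
      rw [← hp, ← hp, EReal.coe_le_coe_iff] at this
      exact le_trans (show h x ≤ _ from hx) this)
    (fun n => hlsc.isClosed_preimage (h (p n))) (fun n => ⟨p n, le_refl (h (p n))⟩)
    (fun n γ hγ h0 h1 => by
      have := hmid γ hγ
      simp only [Set.mem_ofPred_eq] at h0 h1 ⊢
      linarith)
  refine ⟨y, fun x => ?_⟩
  have h1 : (h y : EReal) ≤ sInf (Set.range fun x => (h x : EReal)) := by
    refine ge_of_tendsto' hlim fun n => ?_
    rw [← hp, EReal.coe_le_coe_iff]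
    exact Set.mem_iInter.1 hy n
  exact EReal.coe_le_coe_iff.1 (h1.trans (sInf_le ⟨x, rfl⟩))

end SphericalComparison

/-! ### Barycenters and Jensen's inequality for integrable functions. -/

section Jensen

open Filter Topology

theorem HasDerivAt.nonneg_of_nonneg_right {ψ : ℝ → ℝ} {ψ' : ℝ} (h : HasDerivAt ψ ψ' 0)
    (h0 : ψ 0 = 0) (hnn : ∀ t ∈ Set.Icc (0 : ℝ) 1, 0 ≤ ψ t) : 0 ≤ ψ' := by
  have hlim := (hasDerivWithinAt_iff_tendsto_slope' (s := Set.Ioi 0) (lt_irrefl 0)).1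
    h.hasDerivWithinAt
  refine ge_of_tendsto hlim ?_
  filter_upwards [Ioo_mem_nhdsGT (zero_lt_one' ℝ)] with t ht
  rw [slope_def_field, h0, sub_zero, sub_zero]
  exact div_nonneg (hnn t ⟨ht.1.le, ht.2.le⟩) ht.1.le

variable {Y : Type*} [MetricSpace Y] {r D : ℝ}

/-- The variational inequality at a minimizer `y` of `τ f - cos (r d(·, b))`. -/
theorem SphericalComparison.sq_dist_sub_sq_dist_le (hY : SphericalComparison Y r)
    (hgeo : IsGeodesicSpace Y) (hr : 0 < r) (hD : D < Real.pi / 2)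
    (hdist : ∀ x y : Y, r * dist x y ≤ D) {f : Y → ℝ} (hf : IsGeodesicallyConvexFun f) {τ : ℝ}
    (hτ : 0 < τ) {b y : Y}
    (hmin : ∀ x, τ * f y - Real.cos (r * dist y b) ≤ τ * f x - Real.cos (r * dist x b)) (a : Y) :
    r ^ 2 * (dist a y ^ 2 - dist a b ^ 2) / 2 ≤ τ * (f a - f y) := by
  have hpi := Real.pi_pos
  obtain ⟨γ, hγ, h0, h1⟩ := hgeo y a
  rcases (dist_nonneg : 0 ≤ dist y a).eq_or_lt with hya | hya
  · obtain rfl := dist_eq_zero.1 hya.symm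
    have : 0 ≤ r ^ 2 * dist y b ^ 2 := by positivity
    rw [dist_self, sub_self]
    linarith
  obtain ⟨l, hl⟩ : ∃ l, l = r * dist y a := ⟨_, rfl⟩
  have hl0 : 0 < l := hl ▸ mul_pos hr hya
  have hlD : l ≤ D := hl ▸ hdist y a
  obtain ⟨d, hd⟩ : ∃ d, d = r * dist a b := ⟨_, rfl⟩
  obtain ⟨ε, hε⟩ : ∃ ε, ε = r * dist y b := ⟨_, rfl⟩
  have hsl : 0 < Real.sin l := Real.sin_pos_of_pos_of_lt_pi hl0 (by linarith)
  have hcl : 0 ≤ Real.cos l := Real.cos_nonneg_of_mem_Icc ⟨by linarith, by linarith⟩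
  -- Minimality of `y` tested along the geodesic to `a`. The expression vanishes at `t = 0`, so its
  -- derivative there is nonnegative.
  have hψ : ∀ t ∈ Set.Icc (0 : ℝ) 1, 0 ≤ Real.sin l * (Real.cos ε + t * (τ * (f a - f y))) -
      (Real.sin ((1 - t) * l) * Real.cos ε + Real.sin (t * l) * Real.cos d) := by
    intro t ht
    have k1 := hY b γ hγ ⟨t, ht⟩
    have k2 := hmin (γ ⟨t, ht⟩)
    have k3 := mul_le_mul_of_nonneg_left (hf γ hγ ⟨t, ht⟩) hτ.le
    rw [h0, h1] at k1 k3
    simp only [← hl, ← hd, ← hε] at k1 k2 k3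
    have k4 := mul_le_mul_of_nonneg_left
      (show Real.cos (r * dist (γ ⟨t, ht⟩) b) ≤ Real.cos ε + t * (τ * (f a - f y)) by linarith)
      hsl.le
    linarith
  have hder : HasDerivAt (fun t : ℝ => Real.sin l * (Real.cos ε + t * (τ * (f a - f y))) -
      (Real.sin ((1 - t) * l) * Real.cos ε + Real.sin (t * l) * Real.cos d))
      (Real.sin l * (τ * (f a - f y)) + l * Real.cos l * Real.cos ε - l * Real.cos d) 0 := by
    have e1 := (((hasDerivAt_id (0 : ℝ)).mul_const (τ * (f a - f y))).const_add
      (Real.cos ε)).const_mul (Real.sin l)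
    have e2 := ((((hasDerivAt_id (0 : ℝ)).const_sub 1).mul_const l).sin).mul_const (Real.cos ε)
    have e3 := (((hasDerivAt_id (0 : ℝ)).mul_const l).sin).mul_const (Real.cos d)
    refine (e1.sub (e2.add e3)).congr_deriv ?_
    simp
    ring
  have hnn := hder.nonneg_of_nonneg_right (by simp) hψ
  have hsinc : Real.sin l = l * Real.sinc l := by
    rw [Real.sinc_of_ne_zero hl0.ne']; field_simp
  rw [hsinc] at hnn
  have k1 : 0 ≤ Real.sinc l * (τ * (f a - f y)) + Real.cos l * Real.cos ε - Real.cos d := by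
    refine le_of_mul_le_mul_left ?_ hl0
    linarith
  have k2 := mul_le_of_le_one_right hcl (Real.cos_le_one ε)
  -- Taking `M = l` produces the same factor `sinc l` that multiplies `τ (f a - f y)`, so it
  -- cancels.
  have k3 := two_mul_cos_sub_cos_le (M := l) (d := d) ⟨hl0.le, by linarith⟩
    ⟨by rw [hd]; positivity, by rw [hd]; linarith [hdist a b]⟩
  refine le_of_mul_le_mul_left ?_ (sinc_pos_of_lt hl0.le (by linarith))
  have e : r ^ 2 * (dist a y ^ 2 - dist a b ^ 2) = l ^ 2 - d ^ 2 := by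
    rw [hl, hd, dist_comm y a]; ring
  rw [e]
  linarith

theorem IsGeodesicallyConvexFun.le_midpoint {f : Y → ℝ} (hf : IsGeodesicallyConvexFun f)
    {γ : unitInterval → Y} (hγ : IsMinimalGeodesic γ) :
    f (γ unitIntervalHalf) ≤ (f (γ 0) + f (γ 1)) / 2 := by
  have := hf γ hγ unitIntervalHalf
  rw [coe_unitIntervalHalf] at this
  linarith

theorem SphericalComparison.exists_lowerBound [CompleteSpace Y] [Nonempty Y]
    (hY : SphericalComparison Y r) (hgeo : IsGeodesicSpace Y) (hr : 0 < r)
    (hD : D < Real.pi / 2) (hdist : ∀ x y : Y, r * dist x y ≤ D) {f : Y → ℝ}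
    (hf : IsGeodesicallyConvexFun f) (hlsc : LowerSemicontinuous f) : ∃ m, ∀ x, m ≤ f x := by
  obtain ⟨y, hy⟩ := hY.exists_forall_le hgeo hr hD hdist hlsc fun γ hγ => hf.le_midpoint hγ
  exact ⟨f y, hy⟩

variable [MeasurableSpace Y] [BorelSpace Y] (μ : Measure Y) [IsProbabilityMeasure μ]

theorem integrable_sq_dist {C : ℝ} (hC : ∀ x y : Y, dist x y ≤ C) (y : Y) :
    Integrable (fun a => dist a y ^ 2) μ := by
  refine Integrable.of_bound (C := C ^ 2) ?_ (ae_of_all _ fun a => ?_)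
  · exact ((continuous_id.dist continuous_const).pow 2).measurable.aestronglyMeasurable
  · rw [Real.norm_of_nonneg (sq_nonneg _)]
    exact pow_le_pow_left₀ dist_nonneg (hC a y) 2

theorem continuous_integral_sq_dist {C : ℝ} (hC : ∀ x y : Y, dist x y ≤ C) :
    Continuous fun y => ∫ a, dist a y ^ 2 ∂μ := by
  refine continuous_of_dominated (bound := fun _ => C ^ 2) (fun y => ?_) (fun y => ?_)
    (integrable_const _) (ae_of_all _ fun a => by fun_prop)
  · exact (integrable_sq_dist μ hC y).aestronglyMeasurable
  · refine ae_of_all _ fun a => ?_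
    rw [Real.norm_of_nonneg (sq_nonneg _)]
    exact pow_le_pow_left₀ dist_nonneg (hC a y) 2

theorem SphericalComparison.integral_sq_dist_midpoint (hY : SphericalComparison Y r) (hr : 0 < r)
    (hD : D < Real.pi / 2) (hdist : ∀ x y : Y, r * dist x y ≤ D) {γ : unitInterval → Y}
    (hγ : IsMinimalGeodesic γ) :
    (∫ a, dist a (γ unitIntervalHalf) ^ 2 ∂μ) + Real.cos D / Real.pi ^ 2 * dist (γ 0) (γ 1) ^ 2 ≤
      ((∫ a, dist a (γ 0) ^ 2 ∂μ) + ∫ a, dist a (γ 1) ^ 2 ∂μ) / 2 := by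
  have hC : ∀ x y : Y, dist x y ≤ D / r := fun x y => by
    rw [le_div_iff₀ hr, mul_comm]; exact hdist x y
  have hi := integrable_sq_dist μ hC
  have h := integral_mono ((hi (γ unitIntervalHalf)).add (integrable_const _))
    (((hi (γ 0)).add (hi (γ 1))).div_const 2)
    (fun a => hY.sq_dist_midpoint hr hD hdist a hγ)
  simp only [Pi.add_apply] at h
  rw [integral_add (hi _) (integrable_const _), integral_div, integral_add (hi _) (hi _)] at h
  simpa using h

theorem SphericalComparison.existsUnique_isBarycenter [CompleteSpace Y]
    (hY : SphericalComparison Y r) (hgeo : IsGeodesicSpace Y) (hr : 0 < r)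
    (hD : D < Real.pi / 2) (hdist : ∀ x y : Y, r * dist x y ≤ D) :
    ∃! b : Y, IsBarycenter μ b := by
  have : Nonempty Y := nonempty_of_isProbabilityMeasure μ
  have hD0 : 0 ≤ D := by simpa using hdist (Classical.arbitrary Y) (Classical.arbitrary Y)
  have hc : 0 < Real.cos D / Real.pi ^ 2 :=
    div_pos (Real.cos_pos_of_mem_Ioo ⟨by linarith [Real.pi_pos], hD⟩) (pow_pos Real.pi_pos 2)
  have hmid := fun γ hγ => hY.integral_sq_dist_midpoint μ hr hD hdist (γ := γ) hγ
  obtain ⟨b, hb⟩ := hY.exists_forall_le hgeo hr hD hdist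
    (continuous_integral_sq_dist μ (C := D / r) fun x y => by
      rw [le_div_iff₀ hr, mul_comm]; exact hdist x y).lowerSemicontinuous
    (fun γ hγ => by
      have : 0 ≤ Real.cos D / Real.pi ^ 2 * dist (γ 0) (γ 1) ^ 2 := by positivity
      linarith [hmid γ hγ])
  refine ⟨b, hb, fun b' hb' => ?_⟩
  -- The midpoint of two distinct minimizers would have a strictly smaller integral.
  obtain ⟨γ, hγ, rfl, rfl⟩ := hgeo b' b
  have h1 := hmid γ hγ
  have h2 := hb (γ unitIntervalHalf)
  have h3 := hb' (γ 1)
  refine dist_eq_zero.1 (pow_eq_zero_iff two_ne_zero |>.1 (le_antisymm ?_ (sq_nonneg _)))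
  refine le_of_mul_le_mul_left ?_ hc
  linarith

theorem SphericalComparison.le_integral_of_isBarycenter [CompleteSpace Y]
    (hY : SphericalComparison Y r) (hgeo : IsGeodesicSpace Y) (hr : 0 < r)
    (hD : D < Real.pi / 2) (hdist : ∀ x y : Y, r * dist x y ≤ D) {f : Y → ℝ}
    (hf : IsGeodesicallyConvexFun f) (hlsc : LowerSemicontinuous f) (hint : Integrable f μ) {b : Y}
    (hb : IsBarycenter μ b) : f b ≤ ∫ a, f a ∂μ := by
  have : Nonempty Y := ⟨b⟩
  have hpi := Real.pi_pos
  have hD0 : 0 ≤ D := by simpa using hdist b b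
  have hcD : 0 < Real.cos D := Real.cos_pos_of_mem_Ioo ⟨by linarith, hD⟩
  obtain ⟨m, hm⟩ := hY.exists_lowerBound hgeo hr hD hdist hf hlsc
  have hres : ∀ τ : ℝ, 0 < τ → ∃ y, f y ≤ ∫ a, f a ∂μ ∧
      1 - Real.cos (r * dist y b) ≤ τ * (f b - m) := by
    intro τ hτ
    have hcos : Continuous fun x => -Real.cos (r * dist x b) := by fun_prop
    obtain ⟨y, hy⟩ := hY.exists_forall_le hgeo hr hD hdist
      (h := fun x => τ * f x + -Real.cos (r * dist x b))
      (((continuous_const_mul τ).comp_lowerSemicontinuous hlsc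
        (monotone_mul_left_of_nonneg hτ.le)).add hcos.lowerSemicontinuous)
      (fun γ hγ => by
        have h1 := hY.cos_midpoint hr hD hdist b hγ
        have h2 := mul_le_mul_of_nonneg_left (hf.le_midpoint hγ) hτ.le
        have h3 : 0 ≤ Real.cos D / (2 * Real.pi ^ 2) * (r * dist (γ 0) (γ 1)) ^ 2 := by positivity
        linarith)
    simp only [← sub_eq_add_neg] at hy
    refine ⟨y, ?_, ?_⟩
    · have hC : ∀ x y : Y, dist x y ≤ D / r := fun x y => by
        rw [le_div_iff₀ hr, mul_comm]; exact hdist x y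
      have hi := integrable_sq_dist μ hC
      have h := integral_mono ((((hi y).sub (hi b)).const_mul (r ^ 2)).div_const 2)
        ((hint.sub (integrable_const (f y))).const_mul τ)
        (fun a => hY.sq_dist_sub_sq_dist_le hgeo hr hD hdist hf hτ hy a)
      simp only [Pi.sub_apply] at h
      rw [integral_div, integral_const_mul, integral_const_mul, integral_sub (hi y) (hi b),
        integral_sub hint (integrable_const _), integral_const, probReal_univ, one_smul] at h
      have h1 := mul_nonneg (sq_nonneg r) (sub_nonneg.2 (hb y))
      have h2 : τ * 0 ≤ τ * ((∫ a, f a ∂μ) - f y) := by linarith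
      linarith [le_of_mul_le_mul_left h2 hτ]
    · have h1 := hy b
      rw [dist_self, mul_zero, Real.cos_zero] at h1
      have h2 := mul_le_mul_of_nonneg_left (hm y) hτ.le
      linarith
  by_contra! hlt
  obtain ⟨δ, hδ, hball⟩ := Metric.eventually_nhds_iff.1 (hlsc b _ hlt)
  have hfm : 0 ≤ f b - m := sub_nonneg.2 (hm b)
  -- This `τ` makes `1 - cos (r d(y, b))` less than `2 (r δ)² / π²`, which forces `d(y, b) < δ`; the
  -- `+ 1` covers `f b = m`.
  obtain ⟨y, hy1, hy2⟩ := hres (2 / Real.pi ^ 2 * (r * δ) ^ 2 / (f b - m + 1)) (by positivity)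
  have hbound := Real.cos_le_one_sub_mul_cos_sq (x := r * dist y b)
    (by rw [abs_of_nonneg (by positivity)]; linarith [hdist y b])
  have hc : 0 < 2 / Real.pi ^ 2 * (r * δ) ^ 2 := by positivity
  have h3 : 2 / Real.pi ^ 2 * (r * δ) ^ 2 / (f b - m + 1) * (f b - m) <
      2 / Real.pi ^ 2 * (r * δ) ^ 2 := by
    rw [div_mul_eq_mul_div, div_lt_iff₀ (by linarith)]
    exact mul_lt_mul_of_pos_left (by linarith) hc
  have h4 : (r * dist y b) ^ 2 < (r * δ) ^ 2 := by
    refine lt_of_mul_lt_mul_left ?_ (by positivity : 0 ≤ 2 / Real.pi ^ 2)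
    linarith
  have h5 : dist y b < δ :=
    lt_of_mul_lt_mul_left (lt_of_pow_lt_pow_left₀ 2 (by positivity) h4) hr.le
  exact (hball h5).not_ge hy1

end Jensen

/-! ### The extended integral and the conclusion. -/

theorem lintegral_ofReal_neg_lt_top {Y : Type*} [MeasurableSpace Y] (μ : Measure Y)
    [IsProbabilityMeasure μ] {f : Y → ℝ} {m : ℝ} (hm : ∀ x, m ≤ f x) :
    ∫⁻ a, ENNReal.ofReal (-f a) ∂μ < ⊤ := by
  calc ∫⁻ a, ENNReal.ofReal (-f a) ∂μ ≤ ∫⁻ _, ENNReal.ofReal (-m) ∂μ :=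
        lintegral_mono fun a => ENNReal.ofReal_le_ofReal (neg_le_neg (hm a))
    _ < ⊤ := by simp

/-- Either the positive part has infinite integral and the right side is `⊤`, or `f` is integrable
and the extended integral is the usual one. -/
theorem coe_le_extIntegral {Y : Type*} [MeasurableSpace Y] (μ : Measure Y) {f : Y → ℝ}
    (hf : Measurable f)
    (hneg : ∫⁻ a, ENNReal.ofReal (-f a) ∂μ < ⊤) {c : ℝ}
    (h : Integrable f μ → c ≤ ∫ a, f a ∂μ) : (c : EReal) ≤ extIntegral μ f := by
  rw [extIntegral]
  rcases eq_or_ne (∫⁻ a, ENNReal.ofReal (f a) ∂μ) ⊤ with hpos | hpos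
  · rw [hpos, EReal.coe_ennreal_top, EReal.top_sub]
    · exact le_top
    · simpa using hneg.ne
  · have hint : Integrable f μ := by
      refine ⟨hf.aestronglyMeasurable, ?_⟩
      rw [hasFiniteIntegral_iff_norm]
      calc ∫⁻ a, ENNReal.ofReal ‖f a‖ ∂μ
          ≤ ∫⁻ a, (ENNReal.ofReal (f a) + ENNReal.ofReal (-f a)) ∂μ := by
            refine lintegral_mono fun a => ?_
            rcases abs_cases (f a) with h | h <;> rw [Real.norm_eq_abs, h.1] <;> simp
        _ = _ := lintegral_add_left hf.ennreal_ofReal _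
        _ < ⊤ := ENNReal.add_lt_top.2 ⟨hpos.lt_top, hneg⟩
    have h1 := h hint
    rw [integral_eq_lintegral_pos_part_sub_lintegral_neg_part hint] at h1
    rw [← EReal.coe_ennreal_toReal hpos, ← EReal.coe_ennreal_toReal hneg.ne, ← EReal.coe_sub]
    exact EReal.coe_le_coe_iff.2 h1

theorem proposition6 {X : Type*} [MetricSpace X] [CompleteSpace X] [MeasurableSpace X]
    [BorelSpace X] (κ : ℝ) (hκ : 0 < κ) (hX : CurvatureBoundedAbove X κ)
    (G : Set X) (hG : IsClosed G) (hGconv : IsGeodesicallyConvex G)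
    (hdiam : Metric.ediam G < ENNReal.ofReal (Real.pi / (2 * √κ)))
    (μ : Measure G) [IsProbabilityMeasure μ]
    (f : G → ℝ) (hfconv : IsGeodesicallyConvexFun f) (hflsc : LowerSemicontinuous f) :
    (∃! b : G, IsBarycenter μ b) ∧
    (∫⁻ a, ENNReal.ofReal (-f a) ∂μ) < ⊤ ∧
    ∀ b : G, IsBarycenter μ b → (f b : EReal) ≤ extIntegral μ f := by
  have hr : 0 < √κ := Real.sqrt_pos.2 hκ
  have hpi := Real.pi_pos
  have : CompleteSpace G := hG.completeSpace_coe
  have hfin : Metric.ediam G ≠ ⊤ := (hdiam.trans ENNReal.ofReal_lt_top).ne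
  have hdist' : ∀ x ∈ G, ∀ y ∈ G, √κ * dist x y ≤ √κ * Metric.diam G := fun x hx y hy =>
    mul_le_mul_of_nonneg_left (Metric.dist_le_diam_of_mem' hfin hx hy) hr.le
  have hD : √κ * Metric.diam G < Real.pi / 2 := by
    have h1 : Metric.diam G < Real.pi / (2 * √κ) := ENNReal.toReal_lt_of_lt_ofReal hdiam
    have h2 := mul_lt_mul_of_pos_left h1 hr
    have h3 : √κ * (Real.pi / (2 * √κ)) = Real.pi / 2 := by field_simp
    rwa [h3] at h2
  have hdist : ∀ x y : G, √κ * dist x y ≤ √κ * Metric.diam G := fun x y =>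
    hdist' x x.2 y y.2
  have hY : SphericalComparison G √κ := hX.sphericalComparison hκ fun x hx y hy =>
    (hdist' x hx y hy).trans_lt hD
  have hgeo : IsGeodesicSpace G := hX.1.subtype hGconv
  have : Nonempty G := nonempty_of_isProbabilityMeasure μ
  obtain ⟨m, hm⟩ := hY.exists_lowerBound hgeo hr hD hdist hfconv hflsc
  have hneg := lintegral_ofReal_neg_lt_top μ hm
  exact ⟨hY.existsUnique_isBarycenter μ hgeo hr hD hdist, hneg, fun b hb =>
    coe_le_extIntegral μ hflsc.measurable hneg fun hint =>
      hY.le_integral_of_isBarycenter μ hgeo hr hD hdist hfconv hflsc hint hb⟩
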